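/- Let $X$ be the graph with vertex set $\mathbb{Z}^2$ in which two vertices $(x,y)$, $(x',y')$ are joined by an edge if and only if $|x-x'|+|y-y'|=1$. For $A\subset\mathbb{Z}^2$ let $\partial A$ be the set of vertices not in $A$ that are adjacent to a vertex of $A$. Two subsets of $\mathbb{Z}^2$ are congruent if a graph automorphism of $X$ maps one onto the other. For $\alpha,\beta\in\mathbb{N}=\{0,1,2,\dots\}$ let $$B(\alpha,\beta)=\{(x,y)\in\mathbb{Z}^2 : 0\le y-x\le\alpha,\ 0\le y+x\le\beta\},$$ $$\hat B(\alpha,\beta)=\{(x,y)\in\mathbb{Z}^2 : 0\le y-x\le\alpha,\ -1\le y+x\le\beta-1\}.$$ A box is a non-empty set congruent to some $B(\alpha,\beta)$, or to some $\hat B(\alpha,\beta)$ with $\alpha,\beta$ even. A set $A$ is efficient if it is finite and $|B|\le|A|$ for every finite $B\subset\mathbb{Z}^2$ with $|\partial B|=|\partial A|$; it is minimal if it is finite and $|\partial A|\le|\partial B|$ for every $B\subset\mathbb{Z}^2$ with $|B|=|A|$; it is saturated if $|\partial(A\cup\{v\})|>|\partial A|$ for every $v\in\mathbb{Z}^2\setminus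 A$. **Theorem D.** A non-empty subset $A$ of $\mathbb{Z}^2$ is efficient if and only if it is congruent to $B(n,n)$, to $B(n,n+1)$, or to $B(2n,2n+2)$ for some $n\in\mathbb{N}$ (the sets $B(2n,2n+2)$ are the sets $B(m-1,m+1)$ with $m$ odd). Moreover, every non-empty efficient set is minimal, saturated and a box. -/

import Mathlib

namespace LatticeIso

/-- The graph with vertex set `ℤ²` in which two vertices are adjacent if and only if their
`ℓ₁`-distance is one. -/
def latticeGraph : SimpleGraph (ℤ × ℤ) where
  Adj p q := |p.1 - q.1| + |p.2 - q.2| = 1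
  symm := ⟨fun p q h => by rwa [abs_sub_comm q.1, abs_sub_comm q.2]⟩
  loopless := ⟨fun p h => by simp at h⟩

/-- The vertex boundary of a set `A` of vertices of a graph `G`: the vertices outside `A` that are
adjacent to a vertex of `A`. -/
def vertexBoundary {V : Type*} (G : SimpleGraph V) (A : Set V) : Set V :=
  {u | u ∉ A ∧ ∃ v ∈ A, G.Adj u v}

/-- The vertex boundary in the integer lattice. -/
abbrev bdry (A : Set (ℤ × ℤ)) : Set (ℤ × ℤ) := vertexBoundary latticeGraph A

/-- Two sets of lattice points are congruent if a graph automorphism maps one onto the other. -/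
def Congruent (A B : Set (ℤ × ℤ)) : Prop :=
  ∃ φ : latticeGraph ≃g latticeGraph, φ '' A = B

/-- A finite set is minimal if its vertex boundary has the smallest cardinality among all sets
with the same number of vertices. -/
def IsMinimalSet (A : Set (ℤ × ℤ)) : Prop :=
  A.Finite ∧ ∀ B : Set (ℤ × ℤ), B.encard = A.encard → (bdry A).encard ≤ (bdry B).encard

/-- A finite set is efficient if it has the largest cardinality among all finite sets whose vertex
boundary has the same cardinality. -/
def IsEfficient (A : Set (ℤ × ℤ)) : Prop :=
  A.Finite ∧ ∀ B : Set (ℤ × ℤ), B.Finite → (bdry B).encard = (bdry A).encard →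
    B.encard ≤ A.encard

/-- A set is saturated if adding any further vertex strictly increases the size of its vertex
boundary. -/
def IsSaturated (A : Set (ℤ × ℤ)) : Prop :=
  ∀ v ∉ A, (bdry A).encard < (bdry (A ∪ {v})).encard

/-- The standard box `B(α, β)`. -/
def stdBox (α β : ℕ) : Set (ℤ × ℤ) :=
  {p | 0 ≤ p.2 - p.1 ∧ p.2 - p.1 ≤ α ∧ 0 ≤ p.2 + p.1 ∧ p.2 + p.1 ≤ β}

/-- The shifted standard box, used for even `α` and `β`. -/
def stdBoxHat (α β : ℕ) : Set (ℤ × ℤ) :=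
  {p | 0 ≤ p.2 - p.1 ∧ p.2 - p.1 ≤ α ∧ -1 ≤ p.2 + p.1 ∧ p.2 + p.1 ≤ (β : ℤ) - 1}

/-- A box is a non-empty set that is congruent to a standard box or to a shifted standard box with
even parameters. -/
def IsBox (A : Set (ℤ × ℤ)) : Prop :=
  A.Nonempty ∧ ((∃ α β : ℕ, Congruent A (stdBox α β)) ∨
    ∃ α β : ℕ, Even α ∧ Even β ∧ Congruent A (stdBoxHat α β))

end LatticeIso

/-!
Rotate by 45°, so that edges become diagonal steps and a finite set splits into two colour classes.
For a class `P` occupying `r` rows and `c` columns, Cauchy–Davenport applied along the rows and then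
along the columns shows that `P` has at least `#P + r + c + 1` diagonal neighbours, while
`4 * #P ≤ (r + c) ^ 2`. Adding up over both classes, `8 * |A| ≤ (n - 2) ^ 2 + 4` when `|∂A| = n`.
Squares are `0`, `1` or `4` modulo `8`, so, as `n = 5` does not occur, the sets of maximal size for
given `n` are those with `(n - 2) ^ 2 - 1 ≤ 8 * |A|`. Such near-equality confines the rotated `A` to
a rectangle of half-perimeter at most `n - 2`, and counting the points of that rectangle forces `A`
to be all of it and leaves only the three listed shapes.
-/

namespace LatticeIso

open Finset
open scoped Pointwise

/-! ### Sumsets in torsion-free groups -/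

lemma card_add_mul_card_image_le {G H : Type*} [AddGroup G] [IsAddTorsionFree G] [AddGroup H]
    [DecidableEq G] [DecidableEq H] (f : G →+ H) (T : Finset G) {S : Finset G} (hS : S.Nonempty)
    (hf : ∀ s ∈ S, f s = 0) : #T + (#S - 1) * #(T.image f) ≤ #(T + S) := by
  have hfib : ∀ y, {t ∈ T | f t = y} + S ⊆ {t ∈ T + S | f t = y} := by
    intro y z hz
    obtain ⟨t, ht, s, hs, rfl⟩ := mem_add.1 hz
    rw [mem_filter] at ht ⊢
    exact ⟨add_mem_add ht.1 hs, by rw [map_add, hf s hs, add_zero, ht.2]⟩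
  have hmaps : (↑(T + S) : Set G).MapsTo f ↑(T.image f) := by
    intro z hz
    obtain ⟨t, ht, s, hs, rfl⟩ := mem_add.1 hz
    rw [map_add, hf s hs, add_zero]
    exact mem_image_of_mem f ht
  calc #T + (#S - 1) * #(T.image f)
      = ∑ y ∈ T.image f, (#{t ∈ T | f t = y} + (#S - 1)) := by
        rw [sum_add_distrib, ← card_eq_sum_card_image, sum_const, smul_eq_mul, mul_comm]
    _ ≤ ∑ y ∈ T.image f, #{t ∈ T + S | f t = y} := by
        refine sum_le_sum fun y hy => ?_
        obtain ⟨t, ht, hty⟩ := mem_image.1 hy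
        have hne : {t ∈ T | f t = y}.Nonempty := ⟨t, mem_filter.2 ⟨ht, hty⟩⟩
        rw [← Nat.add_sub_assoc hS.card_pos]
        exact (cauchy_davenport_of_isAddTorsionFree hne hS).trans (card_le_card (hfib y))
    _ = #(T + S) := (card_eq_sum_card_fiberwise hmaps).symm

/-- The unit steps on the line, so that `C + unitSteps` consists of the neighbours of points
of `C`. -/
def unitSteps : Finset ℤ := {1, -1}

/-- The steps between adjacent vertices of the lattice in the coordinates `(y - x, y + x)`. -/
def diagSteps : Finset (ℤ × ℤ) := unitSteps ×ˢ unitSteps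

lemma mem_unitSteps {x : ℤ} : x ∈ unitSteps ↔ x = 1 ∨ x = -1 := by
  rw [unitSteps, mem_insert, mem_singleton]

lemma card_lt_card_add_unitSteps {C : Finset ℤ} (hC : C.Nonempty) : #C < #(C + unitSteps) := by
  have h := cauchy_davenport_of_isAddTorsionFree hC (show unitSteps.Nonempty from ⟨1, by decide⟩)
  rw [show #unitSteps = 2 from rfl] at h
  omega

lemma inter_eq_erase {α : Type*} [DecidableEq α] {X Y : Finset α} {a : α} (haX : a ∈ X)
    (haY : a ∉ Y) (h : #X ≤ #(X ∩ Y) + 1) : X ∩ Y = X.erase a := by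
  refine eq_of_subset_of_card_le (fun x hx => ?_) (by rw [card_erase_of_mem haX]; omega)
  rw [mem_inter] at hx
  exact mem_erase.2 ⟨fun hxa => haY (hxa ▸ hx.2), hx.1⟩

/-- Both `C + 1` without its largest element and `C - 1` without its smallest element are then
equal to `(C + 1) ∩ (C - 1)`; compare the sums of their elements. -/
lemma max'_sub_min'_add_two {C : Finset ℤ} (hC : C.Nonempty) (h : #(C + unitSteps) ≤ #C + 1) :
    C.max' hC - C.min' hC + 2 = 2 * #C := by
  set U := C.image (· + 1) with hU
  set L := C.image (· + -1) with hL
  have hUL : C + unitSteps = U ∪ L := by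
    rw [unitSteps, insert_eq, add_union, add_singleton, add_singleton]
    rfl
  have hUcard : #U = #C := card_image_of_injective _ (add_left_injective 1)
  have hLcard : #L = #C := card_image_of_injective _ (add_left_injective (-1))
  have hinter := card_union_add_card_inter U L
  have hmaxU : C.max' hC + 1 ∈ U := mem_image_of_mem _ (C.max'_mem hC)
  have hminL : C.min' hC + -1 ∈ L := mem_image_of_mem _ (C.min'_mem hC)
  have hmaxL : C.max' hC + 1 ∉ L := by
    rw [hL, mem_image]
    rintro ⟨x, hx, hx'⟩
    have := C.le_max' x hx
    omega
  have hminU : C.min' hC + -1 ∉ U := by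
    rw [hU, mem_image]
    rintro ⟨x, hx, hx'⟩
    have := C.min'_le x hx
    omega
  rw [hUL] at h
  have hUerase := inter_eq_erase hmaxU hmaxL (by omega)
  have hLerase := inter_eq_erase hminL hminU (by rw [inter_comm]; omega)
  have hsum : ∀ k : ℤ, ∑ x ∈ C.image (· + k), x = ∑ x ∈ C, x + #C * k := by
    intro k
    rw [sum_image (add_left_injective k).injOn, sum_add_distrib, sum_const, nsmul_eq_mul]
  have hUsum := sum_erase_eq_sub (f := id) hmaxU
  have hLsum := sum_erase_eq_sub (f := id) hminL
  rw [← hUerase] at hUsum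
  rw [← hLerase, inter_comm] at hLsum
  simp only [id, hU, hL, hsum] at hUsum hLsum
  linarith

lemma exists_union_subset_Ico {C D : Finset ℤ} (hC : C.Nonempty) (hD : D.Nonempty)
    (hCD : C ⊆ D + unitSteps) (hDC : D ⊆ C + unitSteps) (hCcard : #(C + unitSteps) ≤ #C + 1)
    (hDcard : #(D + unitSteps) ≤ #D + 1) : ∃ i : ℤ, C ∪ D ⊆ Ico i (i + (#C + #D : ℕ)) := by
  have hspanC := max'_sub_min'_add_two hC hCcard
  have hspanD := max'_sub_min'_add_two hD hDcard
  have near {X Y : Finset ℤ} (hY : Y.Nonempty) (hXY : X ⊆ Y + unitSteps) :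
      ∀ x ∈ X, Y.min' hY - 1 ≤ x ∧ x ≤ Y.max' hY + 1 := by
    intro x hx
    obtain ⟨y, hy, s, hs, rfl⟩ := mem_add.1 (hXY hx)
    have := Y.min'_le y hy
    have := Y.le_max' y hy
    rw [mem_unitSteps] at hs
    omega
  have hminC := near hD hCD _ (C.min'_mem hC)
  have hmaxC := near hD hCD _ (C.max'_mem hC)
  have hminD := near hC hDC _ (D.min'_mem hD)
  have hmaxD := near hC hDC _ (D.max'_mem hD)
  refine ⟨min (C.min' hC) (D.min' hD), fun x hx => ?_⟩
  rw [mem_Ico]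
  rcases mem_union.1 hx with hx | hx
  · have := C.min'_le x hx
    have := C.le_max' x hx
    omega
  · have := D.min'_le x hx
    have := D.le_max' x hx
    omega

/-! ### Diagonal neighbourhoods -/

lemma add_diagSteps_eq_add_fst (T : Finset (ℤ × ℤ)) :
    T + diagSteps = T + unitSteps ×ˢ {0} + {0} ×ˢ unitSteps := by
  rw [add_assoc, product_add_product_comm, add_singleton, singleton_add]
  simp [diagSteps]

lemma add_diagSteps_eq_add_snd (T : Finset (ℤ × ℤ)) :
    T + diagSteps = T + {0} ×ˢ unitSteps + unitSteps ×ˢ {0} := by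
  rw [add_diagSteps_eq_add_fst, add_right_comm]

lemma image_fst_add_diagSteps (T : Finset (ℤ × ℤ)) :
    (T + diagSteps).image Prod.fst = T.image Prod.fst + unitSteps :=
  image_add (AddMonoidHom.fst ℤ ℤ)

lemma image_snd_add_diagSteps (T : Finset (ℤ × ℤ)) :
    (T + diagSteps).image Prod.snd = T.image Prod.snd + unitSteps :=
  image_add (AddMonoidHom.snd ℤ ℤ)

lemma card_add_card_image_snd_le (T : Finset (ℤ × ℤ)) :
    #T + #(T.image Prod.snd) ≤ #(T + unitSteps ×ˢ {0}) := by
  simpa [unitSteps] using card_add_mul_card_image_le (AddMonoidHom.snd ℤ ℤ) T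
    (S := unitSteps ×ˢ {0}) ⟨(1, 0), by decide⟩ (by decide)

lemma card_add_card_image_fst_le (T : Finset (ℤ × ℤ)) :
    #T + #(T.image Prod.fst) ≤ #(T + {0} ×ˢ unitSteps) := by
  simpa [unitSteps] using card_add_mul_card_image_le (AddMonoidHom.fst ℤ ℤ) T
    (S := {0} ×ˢ unitSteps) ⟨(0, 1), by decide⟩ (by decide)

lemma card_add_card_snd_add_card_fst_add_unitSteps_le (T : Finset (ℤ × ℤ)) :
    #T + #(T.image Prod.snd) + #(T.image Prod.fst + unitSteps) ≤ #(T + diagSteps) := by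
  have hrow := card_add_card_image_snd_le T
  have hcol := card_add_card_image_fst_le (T + unitSteps ×ˢ {0})
  have himage : (T + unitSteps ×ˢ {0}).image Prod.fst = T.image Prod.fst + unitSteps :=
    image_add (AddMonoidHom.fst ℤ ℤ)
  rw [himage, ← add_diagSteps_eq_add_fst] at hcol
  omega

lemma card_add_card_fst_add_card_snd_add_unitSteps_le (T : Finset (ℤ × ℤ)) :
    #T + #(T.image Prod.fst) + #(T.image Prod.snd + unitSteps) ≤ #(T + diagSteps) := by
  have hcol := card_add_card_image_fst_le T
  have hrow := card_add_card_image_snd_le (T + {0} ×ˢ unitSteps)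
  have himage : (T + {0} ×ˢ unitSteps).image Prod.snd = T.image Prod.snd + unitSteps :=
    image_add (AddMonoidHom.snd ℤ ℤ)
  rw [himage, ← add_diagSteps_eq_add_snd] at hrow
  omega

/-- The number of columns plus the number of rows met by `T`. -/
def lineCount (T : Finset (ℤ × ℤ)) : ℕ := #(T.image Prod.fst) + #(T.image Prod.snd)

lemma two_le_lineCount {T : Finset (ℤ × ℤ)} (hT : T.Nonempty) : 2 ≤ lineCount T :=
  Nat.add_le_add (hT.image Prod.fst).card_pos (hT.image Prod.snd).card_pos

lemma four_mul_card_le_lineCount_sq (T : Finset (ℤ × ℤ)) : 4 * #T ≤ lineCount T ^ 2 :=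
  calc 4 * #T ≤ 4 * (#(T.image Prod.fst) * #(T.image Prod.snd)) := by
        rw [← card_product]
        exact Nat.mul_le_mul_left 4 (card_le_card subset_product)
    _ ≤ lineCount T ^ 2 := by
        rw [← mul_assoc]
        exact four_mul_le_pow_two_add _ _

lemma card_add_lineCount_lt {T : Finset (ℤ × ℤ)} (hT : T.Nonempty) :
    #T + lineCount T < #(T + diagSteps) := by
  have := card_add_card_snd_add_card_fst_add_unitSteps_le T
  have := card_lt_card_add_unitSteps (hT.image Prod.fst)
  rw [lineCount]
  omega

lemma card_image_add_unitSteps_le {T : Finset (ℤ × ℤ)}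
    (h : #(T + diagSteps) ≤ #T + lineCount T + 1) :
    #(T.image Prod.fst + unitSteps) ≤ #(T.image Prod.fst) + 1 ∧
      #(T.image Prod.snd + unitSteps) ≤ #(T.image Prod.snd) + 1 := by
  have := card_add_card_snd_add_card_fst_add_unitSteps_le T
  have := card_add_card_fst_add_card_snd_add_unitSteps_le T
  rw [lineCount] at h
  omega

/-! ### Isoperimetry for the two colour classes -/

/-- The size of the vertex boundary in the coordinates `(y - x, y + x)`: steps along edges exchange
the two colours, so the classes `P` and `Q` have their neighbours in the opposite class. -/
def pairBdryCard (P Q : Finset (ℤ × ℤ)) : ℕ := #((P + diagSteps) \ Q) + #((Q + diagSteps) \ P)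

lemma pairBdryCard_comm (P Q : Finset (ℤ × ℤ)) : pairBdryCard P Q = pairBdryCard Q P :=
  add_comm _ _

lemma card_add_lineCount_lt_pairBdryCard_add_card {P : Finset (ℤ × ℤ)} (hP : P.Nonempty)
    (Q : Finset (ℤ × ℤ)) : #P + lineCount P < pairBdryCard P Q + #Q := by
  have := card_add_lineCount_lt hP
  have := le_card_sdiff Q (P + diagSteps)
  rw [pairBdryCard]
  omega

lemma lineCount_add_lineCount_add_two_le {P : Finset (ℤ × ℤ)} (hP : P.Nonempty)
    (Q : Finset (ℤ × ℤ)) : lineCount P + lineCount Q + 2 ≤ pairBdryCard P Q := by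
  have := card_add_lineCount_lt_pairBdryCard_add_card hP Q
  rcases Q.eq_empty_or_nonempty with rfl | hQ
  · have := hP.card_pos
    simp only [lineCount, card_empty, image_empty] at *
    omega
  · have := card_add_lineCount_lt hP
    have := card_add_lineCount_lt hQ
    have := le_card_sdiff Q (P + diagSteps)
    have := le_card_sdiff P (Q + diagSteps)
    rw [pairBdryCard]
    omega

/-- Here `a`, `b` are the sizes of the two colour classes and `p`, `q` their line counts. -/
lemma eight_mul_add_le_of_sub_le {a b p q : ℤ} (hba : b ≤ a) (hp : 4 * a ≤ p ^ 2)
    (hq : 4 * b ≤ q ^ 2) (hp0 : 0 ≤ p) (hq0 : 0 ≤ q) (hab : a - b ≤ q + 1) :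
    8 * (a + b) ≤ (p + q) ^ 2 + 4 := by
  rcases le_or_gt p (q + 2) with hpq | hpq
  · rcases le_or_gt q p with hqp | hqp
    · nlinarith [mul_nonneg (sub_nonneg.2 hpq) (sub_nonneg.2 hqp)]
    · nlinarith
  · nlinarith

/-- The letters are as in `eight_mul_add_le_of_sub_le`; the boundary then has at least
`a - b + p + 1` points. -/
lemma eight_mul_add_add_eight_le {a b p q : ℤ} (hp : 4 * a ≤ p ^ 2) (hq : 4 * b ≤ q ^ 2)
    (hp0 : 0 ≤ p) (hq0 : 0 ≤ q) (hab : q + 2 ≤ a - b) (hab3 : 3 ≤ a - b) :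
    8 * (a + b) + 8 ≤ (a - b + p - 1) ^ 2 := by
  obtain ⟨d, rfl⟩ : ∃ d, a = b + d := ⟨a - b, by ring⟩
  rw [add_sub_cancel_left] at *
  rcases le_or_gt p d with hpd | hpd
  · nlinarith [mul_nonneg (sub_nonneg.2 hpd) (by linarith : 0 ≤ d + 3 * p)]
  · have hb : 4 * b ≤ (d - 2) ^ 2 := hq.trans (pow_le_pow_left₀ hq0 (by linarith) 2)
    nlinarith [mul_nonneg (by linarith : 0 ≤ p - d - 1) (by linarith : 0 ≤ d - 1)]

/-- The first case is the balanced one; in the others `P` dominates `Q`. -/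
lemma pair_isoperimetric_cases {P Q : Finset (ℤ × ℤ)} (hP : P.Nonempty) (hQP : #Q ≤ #P) :
    8 * (#P + #Q : ℤ) ≤ (lineCount P + lineCount Q : ℤ) ^ 2 + 4 ∨
      8 * (#P + #Q : ℤ) + 8 ≤ (pairBdryCard P Q - 2 : ℤ) ^ 2 ∨
      #P = 2 ∧ Q = ∅ ∧ 6 ≤ pairBdryCard P Q := by
  have hn := card_add_lineCount_lt_pairBdryCard_add_card hP Q
  have hp : (4 * #P : ℤ) ≤ (lineCount P : ℤ) ^ 2 := mod_cast four_mul_card_le_lineCount_sq P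
  have hq : (4 * #Q : ℤ) ≤ (lineCount Q : ℤ) ^ 2 := mod_cast four_mul_card_le_lineCount_sq Q
  zify at hQP hn
  rcases le_or_gt (#P - #Q : ℤ) (lineCount Q + 1) with hd | hd
  · exact Or.inl (eight_mul_add_le_of_sub_le hQP hp hq (by omega) (by omega) hd)
  rcases le_or_gt 3 (#P - #Q : ℤ) with hd3 | hd3
  · have := eight_mul_add_add_eight_le hp hq (by omega) (by omega) (by omega) hd3
    refine Or.inr (Or.inl (this.trans ?_))
    exact pow_le_pow_left₀ (by omega) (by omega) 2
  · have hq0 : lineCount Q = 0 := by omega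
    have hQ0 : #Q = 0 := by rw [hq0] at hq; omega
    have hP2 : #P = 2 := by omega
    have hp3 : 3 ≤ lineCount P := by
      by_contra! hlt
      have : lineCount P = 2 := by have := two_le_lineCount hP; omega
      rw [hP2, this] at hp
      norm_num at hp
    exact Or.inr (Or.inr ⟨hP2, card_eq_zero.1 hQ0, by omega⟩)

lemma nonempty_of_card_le {P Q : Finset (ℤ × ℤ)} (h : (P ∪ Q).Nonempty) (hQP : #Q ≤ #P) :
    P.Nonempty := by
  by_contra hP
  rw [not_nonempty_iff_eq_empty] at hP
  subst hP
  simp_all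

lemma pair_isoperimetric {P Q : Finset (ℤ × ℤ)} (h : (P ∪ Q).Nonempty) :
    4 ≤ pairBdryCard P Q ∧ 8 * (#P + #Q : ℤ) ≤ (pairBdryCard P Q - 2 : ℤ) ^ 2 + 4 := by
  wlog hQP : #Q ≤ #P generalizing P Q
  · rw [pairBdryCard_comm, add_comm (#P : ℤ)]
    exact this (by rwa [union_comm]) (by omega)
  have hP := nonempty_of_card_le h hQP
  have hp := two_le_lineCount hP
  have hn := lineCount_add_lineCount_add_two_le hP Q
  refine ⟨by omega, ?_⟩
  rcases pair_isoperimetric_cases hP hQP with hbal | hdom | ⟨hP2, rfl, h6⟩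
  · have : (lineCount P + lineCount Q : ℤ) ^ 2 ≤ (pairBdryCard P Q - 2 : ℤ) ^ 2 :=
      pow_le_pow_left₀ (by omega) (by omega) 2
    linarith
  · linarith
  · have : (4 : ℤ) ^ 2 ≤ (pairBdryCard P ∅ - 2 : ℤ) ^ 2 :=
      pow_le_pow_left₀ (by norm_num) (by omega) 2
    rw [hP2, card_empty]
    push_cast
    linarith

lemma subset_add_diagSteps_of_pairBdryCard_le {P Q : Finset (ℤ × ℤ)} (hP : P.Nonempty)
    (hQ : Q.Nonempty) (h : pairBdryCard P Q ≤ lineCount P + lineCount Q + 2) :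
    Q ⊆ P + diagSteps ∧ #(P + diagSteps) ≤ #P + lineCount P + 1 := by
  have := card_add_lineCount_lt hP
  have := card_add_lineCount_lt hQ
  have := card_sdiff_add_card_inter (P + diagSteps) Q
  have := card_sdiff_add_card_inter (Q + diagSteps) P
  have := card_le_card (inter_subset_right (s₁ := P + diagSteps) (s₂ := Q))
  have := card_le_card (inter_subset_right (s₁ := Q + diagSteps) (s₂ := P))
  rw [pairBdryCard] at h
  exact ⟨inter_eq_right.1 (eq_of_subset_of_card_le inter_subset_right (by omega)), by omega⟩

lemma exists_rectangle_of_pairBdryCard_le {P Q : Finset (ℤ × ℤ)} (hP : P.Nonempty)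
    (hQ : Q.Nonempty) (h : pairBdryCard P Q ≤ lineCount P + lineCount Q + 2) :
    ∃ (i j : ℤ) (w h : ℕ), w + h + 2 ≤ pairBdryCard P Q ∧
      P ∪ Q ⊆ Ico i (i + w) ×ˢ Ico j (j + h) := by
  obtain ⟨hQsub, hPcard⟩ := subset_add_diagSteps_of_pairBdryCard_le hP hQ h
  obtain ⟨hPsub, hQcard⟩ := subset_add_diagSteps_of_pairBdryCard_le hQ hP
    (by rwa [pairBdryCard_comm, add_comm (lineCount Q)])
  obtain ⟨hPfst, hPsnd⟩ := card_image_add_unitSteps_le hPcard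
  obtain ⟨hQfst, hQsnd⟩ := card_image_add_unitSteps_le hQcard
  obtain ⟨i, hi⟩ := exists_union_subset_Ico (hP.image Prod.fst) (hQ.image Prod.fst)
    (image_fst_add_diagSteps Q ▸ image_subset_image hPsub)
    (image_fst_add_diagSteps P ▸ image_subset_image hQsub) hPfst hQfst
  obtain ⟨j, hj⟩ := exists_union_subset_Ico (hP.image Prod.snd) (hQ.image Prod.snd)
    (image_snd_add_diagSteps Q ▸ image_subset_image hPsub)
    (image_snd_add_diagSteps P ▸ image_subset_image hQsub) hPsnd hQsnd
  rw [← image_union] at hi hj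
  refine ⟨i, j, _, _, ?_, subset_product.trans (product_subset_product hi hj)⟩
  have := lineCount_add_lineCount_add_two_le hP Q
  simp only [lineCount] at this
  omega

lemma exists_subset_Ico {C : Finset ℤ} (hC : C.Nonempty) (h : #(C + unitSteps) ≤ #C + 1) :
    ∃ i : ℤ, C ⊆ Ico i (i + (2 * #C - 1 : ℕ)) := by
  have hspan := max'_sub_min'_add_two hC h
  have hpos := hC.card_pos
  refine ⟨C.min' hC, fun x hx => ?_⟩
  have := C.min'_le x hx
  have := C.le_max' x hx
  rw [mem_Ico]
  omega

lemma exists_rectangle_of_card_add_diagSteps_le {P : Finset (ℤ × ℤ)} (hP : P.Nonempty)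
    (h : #(P + diagSteps) ≤ #P + lineCount P + 1) (hle : lineCount P ≤ #P + 1) :
    ∃ (i j : ℤ) (w h : ℕ), w + h + 2 ≤ #(P + diagSteps) ∧
      P ⊆ Ico i (i + w) ×ˢ Ico j (j + h) := by
  obtain ⟨hfst, hsnd⟩ := card_image_add_unitSteps_le h
  obtain ⟨i, hi⟩ := exists_subset_Ico (hP.image Prod.fst) hfst
  obtain ⟨j, hj⟩ := exists_subset_Ico (hP.image Prod.snd) hsnd
  refine ⟨i, j, _, _, ?_, subset_product.trans (product_subset_product hi hj)⟩
  have := card_add_lineCount_lt hP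
  have := (hP.image Prod.fst).card_pos
  have := (hP.image Prod.snd).card_pos
  rw [lineCount] at *
  omega

lemma card_add_diagSteps_le_of_sq_sub_one_le {P : Finset (ℤ × ℤ)} (hP : P.Nonempty)
    (hext : (#(P + diagSteps) - 2 : ℤ) ^ 2 - 1 ≤ 8 * #P) :
    #(P + diagSteps) ≤ #P + lineCount P + 1 ∧ lineCount P ≤ #P + 1 := by
  have hn := card_add_lineCount_lt hP
  have hlines := two_le_lineCount hP
  have harea := four_mul_card_le_lineCount_sq P
  have hsq : (#P + lineCount P - 1 : ℤ) ^ 2 ≤ (#(P + diagSteps) - 2 : ℤ) ^ 2 :=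
    pow_le_pow_left₀ (by omega) (by omega) 2
  have hsmall : #P ≤ 2 := by
    by_contra! h3
    have : 4 ≤ lineCount P := by nlinarith
    zify at h3 this
    nlinarith
  have hpos := hP.card_pos
  rcases (by omega : #P = 1 ∨ #P = 2) with h1 | h2
  · have hsteps : #(P + diagSteps) ≤ #P * 4 := card_add_le
    omega
  · have : #(P + diagSteps) ≤ 6 := by
      by_contra! h7
      rw [h2] at hext
      have : (5 : ℤ) ≤ #(P + diagSteps) - 2 := by omega
      norm_num at hext
      nlinarith
    have : lineCount P ≠ 2 := by
      intro h
      rw [h, h2] at harea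
      omega
    omega

lemma pairBdryCard_le_of_sq_sub_one_le {P Q : Finset (ℤ × ℤ)} (hP : P.Nonempty)
    (hQ : Q.Nonempty) (hQP : #Q ≤ #P)
    (hext : (pairBdryCard P Q - 2 : ℤ) ^ 2 - 1 ≤ 8 * (#P + #Q : ℤ)) :
    pairBdryCard P Q ≤ lineCount P + lineCount Q + 2 := by
  have hp := two_le_lineCount hP
  have hq := two_le_lineCount hQ
  rcases pair_isoperimetric_cases hP hQP with hbal | hdom | ⟨-, hQ0, -⟩
  · by_contra! hlt
    have : (lineCount P + lineCount Q : ℤ) ^ 2 ≤ (pairBdryCard P Q - 3 : ℤ) ^ 2 :=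
      pow_le_pow_left₀ (by omega) (by omega) 2
    have : (7 : ℤ) ≤ pairBdryCard P Q := by omega
    nlinarith
  · linarith
  · exact absurd hQ0 hQ.ne_empty

lemma exists_rectangle_of_sq_sub_one_le {P Q : Finset (ℤ × ℤ)} (h : (P ∪ Q).Nonempty)
    (hext : (pairBdryCard P Q - 2 : ℤ) ^ 2 - 1 ≤ 8 * (#P + #Q : ℤ)) :
    ∃ (i j : ℤ) (w h : ℕ), w + h + 2 ≤ pairBdryCard P Q ∧
      P ∪ Q ⊆ Ico i (i + w) ×ˢ Ico j (j + h) := by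
  wlog hQP : #Q ≤ #P generalizing P Q
  · rw [pairBdryCard_comm, union_comm]
    rw [pairBdryCard_comm, add_comm (#P : ℤ)] at hext
    exact this (by rwa [union_comm]) hext (by omega)
  have hP := nonempty_of_card_le h hQP
  rcases Q.eq_empty_or_nonempty with rfl | hQ
  · have hbdry : pairBdryCard P ∅ = #(P + diagSteps) := by simp [pairBdryCard]
    rw [hbdry, card_empty, Nat.cast_zero, add_zero] at hext
    rw [hbdry, union_empty]
    obtain ⟨hcard, hlines⟩ := card_add_diagSteps_le_of_sq_sub_one_le hP hext
    exact exists_rectangle_of_card_add_diagSteps_le hP hcard hlines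
  · exact exists_rectangle_of_pairBdryCard_le hP hQ
      (pairBdryCard_le_of_sq_sub_one_le hP hQ hQP hext)

/-! ### Rotated coordinates -/

/-- The coordinates `(y - x, y + x)`, in which edges become diagonal steps and boxes become
axis-parallel rectangles. Its image consists of the points with even coordinate sum. -/
def rot (p : ℤ × ℤ) : ℤ × ℤ := (p.2 - p.1, p.2 + p.1)

lemma rot_injective : Function.Injective rot := by
  rintro ⟨a, b⟩ ⟨c, d⟩ h
  simp only [rot, Prod.mk.injEq] at h ⊢
  omega

lemma even_rot (p : ℤ × ℤ) : Even ((rot p).1 + (rot p).2) :=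
  ⟨p.2, by simp only [rot]; ring⟩

lemma exists_rot_eq {z : ℤ × ℤ} (hz : Even (z.1 + z.2)) : ∃ p, rot p = z := by
  obtain ⟨k, hk⟩ := hz
  refine ⟨(k - z.1, k), Prod.ext ?_ ?_⟩ <;> simp only [rot] <;> omega

lemma mem_diagSteps {s : ℤ × ℤ} : s ∈ diagSteps ↔ (s.1 = 1 ∨ s.1 = -1) ∧ (s.2 = 1 ∨ s.2 = -1) := by
  rw [diagSteps, mem_product, mem_unitSteps, mem_unitSteps]

lemma latticeGraph_adj_iff {p q : ℤ × ℤ} : latticeGraph.Adj p q ↔ rot p - rot q ∈ diagSteps := by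
  simp only [latticeGraph, rot, mem_diagSteps, Prod.fst_sub, Prod.snd_sub]
  rcases abs_cases (p.1 - q.1) with h1 | h1 <;> rcases abs_cases (p.2 - q.2) with h2 | h2 <;>
    omega

lemma rot_image_bdry {A : Set (ℤ × ℤ)} {T : Finset (ℤ × ℤ)} (hT : (T : Set (ℤ × ℤ)) = rot '' A) :
    rot '' bdry A = ↑((T + diagSteps) \ T) := by
  have hmem : ∀ p, rot p ∈ T ↔ p ∈ A := fun p => by
    rw [← mem_coe, hT, rot_injective.mem_set_image]
  ext z
  rw [mem_coe, mem_sdiff, mem_add]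
  constructor
  · rintro ⟨u, ⟨hu, v, hv, huv⟩, rfl⟩
    exact ⟨⟨rot v, (hmem v).2 hv, _, latticeGraph_adj_iff.1 huv, add_sub_cancel _ _⟩,
      fun h => hu ((hmem u).1 h)⟩
  · rintro ⟨⟨t, ht, s, hs, rfl⟩, hz⟩
    obtain ⟨v, hv, rfl⟩ : t ∈ rot '' A := hT ▸ ht
    obtain ⟨u, hu⟩ : ∃ u, rot u = rot v + s := exists_rot_eq (by
      have := even_rot v
      rw [mem_diagSteps] at hs
      simp only [Prod.fst_add, Prod.snd_add, Int.even_iff] at *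
      omega)
    rw [← hu] at hz ⊢
    refine ⟨u, ⟨fun h => hz ((hmem u).2 h), v, hv, ?_⟩, rfl⟩
    rwa [latticeGraph_adj_iff, hu, add_sub_cancel_left]

lemma even_fst_add {t s : ℤ × ℤ} (hs : s ∈ diagSteps) : Even (t + s).1 ↔ ¬Even t.1 := by
  have hodd : ¬Even s.1 := (by decide : ∀ s ∈ diagSteps, ¬Even s.1) s hs
  rw [Prod.fst_add, Int.even_add, iff_false_right hodd]

lemma filter_add_eq {G : Type*} [Add G] [DecidableEq G] {p q : G → Prop} [DecidablePred p]
    [DecidablePred q] {S : Finset G} (hpq : ∀ t, ∀ s ∈ S, p (t + s) ↔ q t) (T : Finset G) :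
    {z ∈ T + S | p z} = {t ∈ T | q t} + S := by
  ext z
  simp only [mem_filter, mem_add]
  constructor
  · rintro ⟨⟨t, ht, s, hs, rfl⟩, hz⟩
    exact ⟨t, ⟨ht, (hpq t s hs).1 hz⟩, s, hs, rfl⟩
  · rintro ⟨t, ⟨ht, hqt⟩, s, hs, rfl⟩
    exact ⟨⟨t, ht, s, hs, rfl⟩, (hpq t s hs).2 hqt⟩

lemma filter_sdiff_filter {α : Type*} [DecidableEq α] (p : α → Prop) [DecidablePred p]
    (s t : Finset α) : {x ∈ s | p x} \ {x ∈ t | p x} = {x ∈ s \ t | p x} := by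
  ext x
  simp only [mem_sdiff, mem_filter]
  tauto

lemma card_add_diagSteps_sdiff (T : Finset (ℤ × ℤ)) : #((T + diagSteps) \ T) =
    pairBdryCard {z ∈ T | Even z.1} {z ∈ T | ¬Even z.1} := by
  have hodd : {z ∈ T + diagSteps | ¬Even z.1} = {z ∈ T | Even z.1} + diagSteps :=
    filter_add_eq (fun t s hs => by rw [even_fst_add hs, not_not]) T
  have heven : {z ∈ T + diagSteps | Even z.1} = {z ∈ T | ¬Even z.1} + diagSteps :=
    filter_add_eq (fun t s hs => even_fst_add hs) T
  rw [pairBdryCard_comm, pairBdryCard, ← hodd, ← heven, filter_sdiff_filter, filter_sdiff_filter,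
    card_filter_add_card_filter_not]

lemma exists_colour_classes {A : Set (ℤ × ℤ)} (hA : A.Finite) : ∃ P Q : Finset (ℤ × ℤ),
    (↑(P ∪ Q) : Set (ℤ × ℤ)) = rot '' A ∧ A.ncard = #P + #Q ∧
      (bdry A).ncard = pairBdryCard P Q := by
  obtain ⟨T, hT⟩ := (hA.image rot).exists_finset_coe
  refine ⟨{z ∈ T | Even z.1}, {z ∈ T | ¬Even z.1}, ?_, ?_, ?_⟩
  · rw [filter_union_filter_not_eq, hT]
  · rw [card_filter_add_card_filter_not, ← Set.ncard_coe_finset, hT,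
      Set.ncard_image_of_injective _ rot_injective]
  · rw [← card_add_diagSteps_sdiff, ← Set.ncard_coe_finset, ← rot_image_bdry hT,
      Set.ncard_image_of_injective _ rot_injective]

lemma finite_bdry {A : Set (ℤ × ℤ)} (hA : A.Finite) : (bdry A).Finite := by
  obtain ⟨T, hT⟩ := (hA.image rot).exists_finset_coe
  exact .of_finite_image (rot_image_bdry hT ▸ finite_toSet _) rot_injective.injOn

lemma isoperimetric {A : Set (ℤ × ℤ)} (hA : A.Finite) (hne : A.Nonempty) :
    4 ≤ (bdry A).ncard ∧ 8 * (A.ncard : ℤ) ≤ ((bdry A).ncard - 2 : ℤ) ^ 2 + 4 := by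
  obtain ⟨P, Q, hPQ, hcard, hbdry⟩ := exists_colour_classes hA
  rw [hbdry, hcard, Nat.cast_add]
  refine pair_isoperimetric ?_
  rw [← coe_nonempty, hPQ]
  exact hne.image _

/-! ### Lattice rectangles -/

lemma two_mul_card_filter_even_add (s t : Finset ℤ) :
    2 * (#{p ∈ s ×ˢ t | Even (p.1 + p.2)} : ℤ) =
      #s * #t + (∑ x ∈ s, (x.negOnePow : ℤ)) * ∑ y ∈ t, (y.negOnePow : ℤ) := by
  have hpoint : ∀ p ∈ s ×ˢ t, (if Even (p.1 + p.2) then (2 : ℤ) else 0) =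
      1 + (p.1.negOnePow : ℤ) * (p.2.negOnePow : ℤ) := by
    intro p _
    rw [← Units.val_mul, ← Int.negOnePow_add]
    split_ifs with he
    · rw [Int.negOnePow_even _ he]
      rfl
    · rw [Int.negOnePow_odd _ (Int.not_even_iff_odd.1 he)]
      rfl
  calc 2 * (#{p ∈ s ×ˢ t | Even (p.1 + p.2)} : ℤ)
      = ∑ p ∈ s ×ˢ t, if Even (p.1 + p.2) then (2 : ℤ) else 0 := by
        rw [← sum_filter, sum_const, nsmul_eq_mul, mul_comm]
    _ = _ := by
        rw [sum_congr rfl hpoint, sum_add_distrib, sum_const, card_product, sum_mul_sum,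
          ← sum_product', nsmul_one, Nat.cast_mul]

lemma sum_negOnePow_Ico (i : ℤ) (w : ℕ) :
    ∑ x ∈ Ico i (i + w), (x.negOnePow : ℤ) = if Even w then 0 else (i.negOnePow : ℤ) := by
  have hterm : ∀ k : ℕ, ((i + k).negOnePow : ℤ) = i.negOnePow * (-1) ^ k := fun k => by
    rw [Int.negOnePow_add, Units.val_mul, Int.coe_negOnePow_natCast]
  rw [Int.Ico_eq_finset_map, sum_map, add_sub_cancel_left, Int.toNat_natCast]
  calc ∑ k ∈ range w, ((i + k).negOnePow : ℤ) = i.negOnePow * ∑ k ∈ range w, (-1) ^ k := by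
        rw [sum_congr rfl fun k _ => hterm k, mul_sum]
    _ = if Even w then 0 else (i.negOnePow : ℤ) := by
        rw [neg_one_geom_sum, mul_ite, mul_zero, mul_one]

/-- The lattice points of a `w × h` rectangle in the coordinates `(y - x, y + x)`. -/
def rotRect (i j : ℤ) (w h : ℕ) : Set (ℤ × ℤ) :=
  {p | i ≤ p.2 - p.1 ∧ p.2 - p.1 < i + w ∧ j ≤ p.2 + p.1 ∧ p.2 + p.1 < j + h}

lemma rot_image_rotRect (i j : ℤ) (w h : ℕ) : rot '' rotRect i j w h =
    ↑({p ∈ Ico i (i + w) ×ˢ Ico j (j + h) | Even (p.1 + p.2)} : Finset (ℤ × ℤ)) := by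
  ext z
  rw [mem_coe, mem_filter, mem_product, mem_Ico, mem_Ico]
  constructor
  · rintro ⟨p, ⟨h1, h2, h3, h4⟩, rfl⟩
    exact ⟨⟨⟨h1, h2⟩, h3, h4⟩, even_rot p⟩
  · rintro ⟨⟨⟨h1, h2⟩, h3, h4⟩, heven⟩
    obtain ⟨p, rfl⟩ := exists_rot_eq heven
    exact ⟨p, ⟨h1, h2, h3, h4⟩, rfl⟩

lemma finite_rotRect (i j : ℤ) (w h : ℕ) : (rotRect i j w h).Finite :=
  .of_finite_image (rot_image_rotRect i j w h ▸ finite_toSet _) rot_injective.injOn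

lemma two_mul_ncard_rotRect (i j : ℤ) (w h : ℕ) : 2 * ((rotRect i j w h).ncard : ℤ) =
    w * h + if Even w ∨ Even h then 0 else ((i + j).negOnePow : ℤ) := by
  rw [← Set.ncard_image_of_injective _ rot_injective, rot_image_rotRect, Set.ncard_coe_finset,
    two_mul_card_filter_even_add, Int.card_Ico, Int.card_Ico, sum_negOnePow_Ico,
    sum_negOnePow_Ico, Int.negOnePow_add]
  by_cases hw : Even w <;> by_cases hh : Even h <;> simp [hw, hh]

lemma two_mul_ncard_rotRect_le (i j : ℤ) (w h : ℕ) :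
    2 * ((rotRect i j w h).ncard : ℤ) ≤ w * h + 1 := by
  rw [two_mul_ncard_rotRect]
  split_ifs
  · simp
  · rcases Int.units_eq_one_or (i + j).negOnePow with hu | hu <;> simp [hu]

lemma bdry_rotRect_subset (i j : ℤ) (w h : ℕ) :
    bdry (rotRect i j w h) ⊆ rotRect (i - 1) (j - 1) (w + 2) (h + 2) \ rotRect i j w h := by
  rintro u ⟨hu, v, hv, huv⟩
  refine ⟨?_, hu⟩
  rw [latticeGraph_adj_iff, mem_diagSteps] at huv
  simp only [rotRect, rot, Set.mem_ofPred_eq, Prod.fst_sub, Prod.snd_sub] at hv huv ⊢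
  push_cast
  omega

lemma ncard_bdry_rotRect_le (i j : ℤ) (w h : ℕ) : (bdry (rotRect i j w h)).ncard ≤ w + h + 2 := by
  set R := rotRect i j w h with hR
  set R' := rotRect (i - 1) (j - 1) (w + 2) (h + 2) with hR'
  have hfin' : R'.Finite := finite_rotRect _ _ _ _
  have hsub : R ⊆ R' := by
    intro p
    simp only [hR, hR', rotRect, Set.mem_ofPred_eq]
    push_cast
    omega
  have hsign : (i - 1 + (j - 1)).negOnePow = (i + j).negOnePow := by
    rw [Int.negOnePow_eq_iff]
    exact ⟨-1, by ring⟩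
  have hcard : (R'.ncard : ℤ) = R.ncard + (w + h + 2) := by
    have hcardR := two_mul_ncard_rotRect i j w h
    have hcardR' := two_mul_ncard_rotRect (i - 1) (j - 1) (w + 2) (h + 2)
    simp only [hsign, Nat.even_add, even_two, iff_true] at hcardR'
    push_cast at hcardR'
    linarith
  have hle : (bdry R).ncard ≤ (R' \ R).ncard :=
    Set.ncard_le_ncard (bdry_rotRect_subset i j w h) hfin'.sdiff
  rw [Set.ncard_sdiff hsub (finite_rotRect i j w h)] at hle
  omega

lemma stdBox_eq_rotRect (α β : ℕ) : stdBox α β = rotRect 0 0 (α + 1) (β + 1) := by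
  ext p
  simp only [stdBox, rotRect, Set.mem_ofPred_eq]
  push_cast
  omega

lemma nonempty_stdBox (α β : ℕ) : (stdBox α β).Nonempty := ⟨(0, 0), by simp [stdBox]⟩

lemma finite_stdBox (α β : ℕ) : (stdBox α β).Finite :=
  stdBox_eq_rotRect α β ▸ finite_rotRect _ _ _ _

lemma two_mul_ncard_stdBox (α β : ℕ) : 2 * ((stdBox α β).ncard : ℤ) =
    (α + 1) * (β + 1) + if Even α ∧ Even β then 1 else 0 := by
  rw [stdBox_eq_rotRect, two_mul_ncard_rotRect]
  by_cases hα : Even α <;> by_cases hβ : Even β <;> simp [Nat.even_add_one, hα, hβ]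

lemma ncard_bdry_stdBox_le (α β : ℕ) : (bdry (stdBox α β)).ncard ≤ α + β + 4 := by
  rw [stdBox_eq_rotRect]
  exact (ncard_bdry_rotRect_le _ _ _ _).trans (by omega)

/-! ### Nearly extremal sets -/

/-- A finite set whose size is nearly the largest that `isoperimetric` permits for its boundary.
Since squares are `0`, `1` or `4` modulo `8`, no other finite set with the same boundary size can
then be larger. The condition fails for the empty set. -/
def NearlyExtremal (A : Set (ℤ × ℤ)) : Prop :=
  A.Finite ∧ ((bdry A).ncard - 2 : ℤ) ^ 2 - 1 ≤ 8 * (A.ncard : ℤ)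

lemma NearlyExtremal.nonempty {A : Set (ℤ × ℤ)} (hA : NearlyExtremal A) : A.Nonempty := by
  by_contra hempty
  rw [Set.not_nonempty_iff_eq_empty] at hempty
  subst hempty
  have := hA.2
  simp [vertexBoundary] at this

lemma NearlyExtremal.exists_eq_rotRect {A : Set (ℤ × ℤ)} (hA : NearlyExtremal A) :
    ∃ (i j : ℤ) (w h : ℕ), A = rotRect i j w h ∧ (w + h : ℤ) ^ 2 - 1 ≤ 8 * (A.ncard : ℤ) := by
  obtain ⟨hfin, hext⟩ := hA
  obtain ⟨P, Q, hPQ, hcard, hbdry⟩ := exists_colour_classes hfin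
  have hunion : (P ∪ Q).Nonempty := by
    rw [← coe_nonempty, hPQ]
    exact (NearlyExtremal.nonempty ⟨hfin, hext⟩).image _
  have hext' := hext
  rw [hbdry, hcard, Nat.cast_add] at hext'
  obtain ⟨i, j, w, h, hwh, hrect⟩ := exists_rectangle_of_sq_sub_one_le hunion hext'
  rw [← hbdry] at hwh
  have hsub : A ⊆ rotRect i j w h := by
    intro p hp
    have hmem : rot p ∈ P ∪ Q := by
      rw [← mem_coe, hPQ]
      exact Set.mem_image_of_mem _ hp
    have := hrect hmem
    rw [mem_product, mem_Ico, mem_Ico] at this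
    exact ⟨this.1.1, this.1.2, this.2.1, this.2.2⟩
  have hsq : (w + h : ℤ) ^ 2 ≤ ((bdry A).ncard - 2 : ℤ) ^ 2 :=
    pow_le_pow_left₀ (by positivity) (by omega) 2
  have hle : (rotRect i j w h).ncard ≤ A.ncard := by
    have := two_mul_ncard_rotRect_le i j w h
    zify
    nlinarith [sq_nonneg ((w : ℤ) - h)]
  exact ⟨i, j, w, h, Set.eq_of_subset_of_ncard_le hsub hle (finite_rotRect i j w h), by linarith⟩

/-! ### Congruences -/

lemma Congruent.trans {A B C : Set (ℤ × ℤ)} (hAB : Congruent A B) (hBC : Congruent B C) :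
    Congruent A C := by
  obtain ⟨φ, rfl⟩ := hAB
  obtain ⟨ψ, rfl⟩ := hBC
  exact ⟨φ.trans ψ, (Set.image_image ψ φ A).symm⟩

lemma Congruent.finite_iff {A B : Set (ℤ × ℤ)} (h : Congruent A B) : A.Finite ↔ B.Finite := by
  obtain ⟨φ, rfl⟩ := h
  exact (Set.finite_image_iff φ.injective.injOn).symm

lemma Congruent.ncard_eq {A B : Set (ℤ × ℤ)} (h : Congruent A B) : A.ncard = B.ncard := by
  obtain ⟨φ, rfl⟩ := h
  exact (Set.ncard_image_of_injective _ φ.injective).symm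

lemma image_vertexBoundary {V W : Type*} {G : SimpleGraph V} {H : SimpleGraph W} (φ : G ≃g H)
    (A : Set V) : φ '' vertexBoundary G A = vertexBoundary H (φ '' A) := by
  ext z
  obtain ⟨u, rfl⟩ := φ.surjective z
  rw [φ.injective.mem_set_image]
  simp only [vertexBoundary, Set.mem_ofPred_eq, φ.injective.mem_set_image, Set.exists_mem_image,
    φ.map_adj_iff]

lemma Congruent.ncard_bdry_eq {A B : Set (ℤ × ℤ)} (h : Congruent A B) :
    (bdry A).ncard = (bdry B).ncard := by
  obtain ⟨φ, rfl⟩ := h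
  rw [bdry, bdry, ← image_vertexBoundary, Set.ncard_image_of_injective _ φ.injective]

lemma Congruent.nearlyExtremal_iff {A B : Set (ℤ × ℤ)} (h : Congruent A B) :
    NearlyExtremal A ↔ NearlyExtremal B := by
  rw [NearlyExtremal, NearlyExtremal, h.finite_iff, h.ncard_eq, h.ncard_bdry_eq]

lemma congruent_of_equiv {A B : Set (ℤ × ℤ)} (e : ℤ × ℤ ≃ ℤ × ℤ)
    (hadj : ∀ p q, latticeGraph.Adj (e p) (e q) ↔ latticeGraph.Adj p q)
    (hmem : ∀ p, e p ∈ B ↔ p ∈ A) : Congruent A B := by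
  refine ⟨⟨e, fun {p q} => hadj p q⟩, ?_⟩
  ext z
  obtain ⟨p, rfl⟩ := e.surjective z
  rw [hmem]
  exact e.injective.mem_set_image

lemma congruent_rotRect_translate (k l : ℤ) (w h : ℕ) :
    Congruent (rotRect (l - k) (l + k) w h) (rotRect 0 0 w h) := by
  refine congruent_of_equiv (Equiv.addRight (-k, -l)) (fun p q => by simp [latticeGraph]) ?_
  intro p
  simp only [rotRect, Set.mem_ofPred_eq, Equiv.coe_addRight, Prod.fst_add, Prod.snd_add]
  omega

lemma congruent_rotRect_reflect (i j : ℤ) (w h : ℕ) :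
    Congruent (rotRect i j w h) (rotRect (1 - i - w) j w h) := by
  refine congruent_of_equiv (Equiv.prodComm ℤ ℤ) (fun p q => ?_) fun p => ?_
  · simp only [latticeGraph, Equiv.prodComm_apply, Prod.fst_swap, Prod.snd_swap]
    rw [add_comm]
  · simp only [rotRect, Set.mem_ofPred_eq, Equiv.prodComm_apply, Prod.fst_swap, Prod.snd_swap]
    omega

lemma congruent_rotRect_swap (i j : ℤ) (w h : ℕ) :
    Congruent (rotRect i j w h) (rotRect j i h w) := by
  refine congruent_of_equiv ((Equiv.neg ℤ).prodCongr (Equiv.refl ℤ)) (fun p q => ?_) fun p => ?_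
  · simp only [latticeGraph, Equiv.prodCongr_apply, Prod.map_fst, Prod.map_snd, Equiv.neg_apply,
      Equiv.refl_apply]
    rw [neg_sub_neg, abs_sub_comm]
  · simp only [rotRect, Set.mem_ofPred_eq, Equiv.prodCongr_apply, Prod.map_fst, Prod.map_snd,
      Equiv.neg_apply, Equiv.refl_apply]
    omega

lemma congruent_rotRect_zero_of_even_add {i j : ℤ} (hij : Even (i + j)) (w h : ℕ) :
    Congruent (rotRect i j w h) (rotRect 0 0 w h) := by
  obtain ⟨k, hk⟩ := hij
  have := congruent_rotRect_translate (k - i) k w h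
  rwa [show k - (k - i) = i by ring, show k + (k - i) = j by omega] at this

lemma congruent_rotRect_zero_of_even_width (i j : ℤ) {w : ℕ} (hw : Even w) (h : ℕ) :
    Congruent (rotRect i j w h) (rotRect 0 0 w h) := by
  by_cases hij : Even (i + j)
  · exact congruent_rotRect_zero_of_even_add hij w h
  · refine (congruent_rotRect_reflect i j w h).trans (congruent_rotRect_zero_of_even_add ?_ w h)
    rw [Nat.even_iff] at hw
    rw [Int.even_iff] at *
    omega

lemma congruent_rotRect_zero {i j : ℤ} {w h : ℕ} (heven : (Even w ∨ Even h) ∨ Even (i + j)) :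
    Congruent (rotRect i j w h) (rotRect 0 0 w h) := by
  rcases heven with (hw | hh) | hij
  · exact congruent_rotRect_zero_of_even_width i j hw h
  · exact ((congruent_rotRect_swap i j w h).trans
      (congruent_rotRect_zero_of_even_width j i hh w)).trans (congruent_rotRect_swap 0 0 h w)
  · exact congruent_rotRect_zero_of_even_add hij w h

lemma congruent_stdBox_swap (α β : ℕ) : Congruent (stdBox α β) (stdBox β α) := by
  rw [stdBox_eq_rotRect, stdBox_eq_rotRect]
  exact congruent_rotRect_swap _ _ _ _

/-! ### Classification -/

lemma even_of_sq_sub_one_le {i j : ℤ} {w h : ℕ}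
    (hext : (w + h : ℤ) ^ 2 - 1 ≤ 8 * ((rotRect i j w h).ncard : ℤ)) :
    (Even w ∨ Even h) ∨ Even (i + j) := by
  by_contra! hodd
  have hcard := two_mul_ncard_rotRect i j w h
  rw [if_neg (by tauto), Int.negOnePow_odd _ (Int.not_even_iff_odd.1 hodd.2)] at hcard
  push_cast at hcard
  nlinarith [sq_nonneg ((w : ℤ) - h)]

lemma NearlyExtremal.exists_congruent_stdBox {A : Set (ℤ × ℤ)} (hA : NearlyExtremal A) :
    ∃ α β : ℕ, α ≤ β ∧ Congruent A (stdBox α β) ∧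
      (α + β + 2 : ℤ) ^ 2 - 1 ≤ 8 * ((stdBox α β).ncard : ℤ) := by
  obtain ⟨i, j, w, h, rfl, hext⟩ := hA.exists_eq_rotRect
  obtain ⟨α, β, rfl, rfl⟩ : ∃ α β, w = α + 1 ∧ h = β + 1 := by
    obtain ⟨p, hp⟩ := hA.nonempty
    simp only [rotRect, Set.mem_ofPred_eq] at hp
    exact ⟨w - 1, h - 1, by omega, by omega⟩
  have hcong := congruent_rotRect_zero (even_of_sq_sub_one_le hext)
  rw [← stdBox_eq_rotRect] at hcong
  rw [hcong.ncard_eq] at hext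
  push_cast at hext
  rcases le_total α β with hle | hle
  · exact ⟨α, β, hle, hcong, by linarith⟩
  · refine ⟨β, α, hle, hcong.trans (congruent_stdBox_swap α β), ?_⟩
    rw [← (congruent_stdBox_swap α β).ncard_eq]
    linarith

/-- The shapes arise from
`(α + β + 2) ^ 2 - 4 * (α + 1) * (β + 1) = (β - α) ^ 2`. -/
lemma sq_sub_one_le_eight_mul_ncard_stdBox_iff {α β : ℕ} (hle : α ≤ β) :
    (α + β + 2 : ℤ) ^ 2 - 1 ≤ 8 * ((stdBox α β).ncard : ℤ) ↔
      β = α ∨ β = α + 1 ∨ Even α ∧ β = α + 2 := by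
  obtain ⟨d, rfl⟩ := Nat.exists_eq_add_of_le hle
  have hcard := two_mul_ncard_stdBox α (α + d)
  push_cast at hcard ⊢
  constructor
  · intro hext
    split_ifs at hcard with heven
    · have hd : d < 3 := by
        zify
        nlinarith
      interval_cases d <;> simp [heven.1]
    · have hd : d < 2 := by
        zify
        nlinarith
      interval_cases d <;> simp
  · intro hshape
    simp only [Nat.add_eq_left, Nat.add_left_cancel_iff] at hshape
    rcases hshape with rfl | rfl | ⟨heven, rfl⟩
    · split_ifs at hcard <;> push_cast at hcard ⊢ <;> nlinarith
    · split_ifs at hcard <;> push_cast at hcard ⊢ <;> nlinarith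
    · rw [if_pos ⟨heven, heven.add even_two⟩] at hcard
      push_cast at hcard ⊢
      nlinarith

lemma nearlyExtremal_stdBox {α β : ℕ}
    (hext : (α + β + 2 : ℤ) ^ 2 - 1 ≤ 8 * ((stdBox α β).ncard : ℤ)) :
    NearlyExtremal (stdBox α β) := by
  have hle := ncard_bdry_stdBox_le α β
  have hfour := (isoperimetric (finite_stdBox α β) (nonempty_stdBox α β)).1
  have : ((bdry (stdBox α β)).ncard - 2 : ℤ) ^ 2 ≤ (α + β + 2 : ℤ) ^ 2 :=
    pow_le_pow_left₀ (by omega) (by omega) 2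
  exact ⟨finite_stdBox α β, by linarith⟩

lemma nearlyExtremal_iff_congruent {A : Set (ℤ × ℤ)} : NearlyExtremal A ↔
    ∃ n : ℕ, Congruent A (stdBox n n) ∨ Congruent A (stdBox n (n + 1)) ∨
      Congruent A (stdBox (2 * n) (2 * n + 2)) := by
  constructor
  · intro hA
    obtain ⟨α, β, hle, hcong, hext⟩ := hA.exists_congruent_stdBox
    rcases (sq_sub_one_le_eight_mul_ncard_stdBox_iff hle).1 hext with rfl | rfl | ⟨heven, rfl⟩
    · exact ⟨β, Or.inl hcong⟩
    · exact ⟨α, Or.inr (Or.inl hcong)⟩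
    · obtain ⟨n, rfl⟩ := heven.two_dvd
      exact ⟨n, Or.inr (Or.inr hcong)⟩
  · have hbox {α β : ℕ} (hle : α ≤ β) (hshape : β = α ∨ β = α + 1 ∨ Even α ∧ β = α + 2)
        (hcong : Congruent A (stdBox α β)) : NearlyExtremal A :=
      hcong.nearlyExtremal_iff.2
        (nearlyExtremal_stdBox ((sq_sub_one_le_eight_mul_ncard_stdBox_iff hle).2 hshape))
    rintro ⟨n, hn | hn | hn⟩
    · exact hbox le_rfl (Or.inl rfl) hn
    · exact hbox (Nat.le_succ n) (Or.inr (Or.inl rfl)) hn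
    · exact hbox (Nat.le_add_right _ 2) (Or.inr (Or.inr ⟨even_two_mul n, rfl⟩)) hn

/-! ### Efficient sets -/

lemma ncard_bdry_singleton_le (v : ℤ × ℤ) : (bdry {v}).ncard ≤ 4 := by
  have hv : ({v} : Set (ℤ × ℤ)) = rotRect (v.2 - v.1) (v.2 + v.1) 1 1 := by
    ext p
    simp only [rotRect, Set.mem_singleton_iff, Set.mem_ofPred_eq, Prod.ext_iff]
    push_cast
    omega
  rw [hv]
  exact ncard_bdry_rotRect_le _ _ 1 1

lemma ncard_bdry_ne_five {A : Set (ℤ × ℤ)} (hA : A.Finite) (hne : A.Nonempty) :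
    (bdry A).ncard ≠ 5 := by
  intro hfive
  have hiso := (isoperimetric hA hne).2
  have hpos := (Set.ncard_pos hA).2 hne
  rw [hfive] at hiso
  obtain ⟨v, rfl⟩ := Set.ncard_eq_one.1 (by omega : A.ncard = 1)
  have := ncard_bdry_singleton_le v
  omega

lemma ncard_bdry_stdBox {α β : ℕ} (hshape : β = α ∨ β = α + 1) (hne : α + β ≠ 1) :
    (bdry (stdBox α β)).ncard = α + β + 4 := by
  have hle := ncard_bdry_stdBox_le α β
  obtain ⟨hfour, hiso⟩ := isoperimetric (finite_stdBox α β) (nonempty_stdBox α β)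
  have hext : (α + β + 2 : ℤ) ^ 2 - 1 ≤ 8 * ((stdBox α β).ncard : ℤ) :=
    (sq_sub_one_le_eight_mul_ncard_stdBox_iff (by omega)).2 (hshape.imp_right Or.inl)
  by_contra hlt
  have : ((bdry (stdBox α β)).ncard - 2 : ℤ) ^ 2 ≤ (α + β + 1 : ℤ) ^ 2 :=
    pow_le_pow_left₀ (by omega) (by omega) 2
  have : (2 : ℤ) ≤ α + β := by omega
  nlinarith

lemma NearlyExtremal.isEfficient {A : Set (ℤ × ℤ)} (hA : NearlyExtremal A) : IsEfficient A := by
  obtain ⟨hfin, hext⟩ := hA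
  refine ⟨hfin, fun B hB hbdry => ?_⟩
  rcases B.eq_empty_or_nonempty with rfl | hne
  · simp
  have hiso := (isoperimetric hB hne).2
  have hncard : (bdry B).ncard = (bdry A).ncard := congrArg ENat.toNat hbdry
  rw [hncard] at hiso
  rw [← hB.cast_ncard_eq, ← hfin.cast_ncard_eq, Nat.cast_le]
  omega

/-- Compare with `stdBox α β` for `α + β + 4` equal to the boundary size. -/
lemma IsEfficient.nearlyExtremal {A : Set (ℤ × ℤ)} (hA : IsEfficient A) (hne : A.Nonempty) :
    NearlyExtremal A := by
  obtain ⟨hfin, hmax⟩ := hA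
  have hfour := (isoperimetric hfin hne).1
  have hfive := ncard_bdry_ne_five hfin hne
  obtain ⟨α, β, hshape, hn⟩ : ∃ α β : ℕ, (β = α ∨ β = α + 1) ∧ (bdry A).ncard = α + β + 4 :=
    ⟨((bdry A).ncard - 4) / 2, ((bdry A).ncard - 3) / 2, by omega, by omega⟩
  have hbdry : (bdry (stdBox α β)).encard = (bdry A).encard := by
    rw [← (finite_bdry (finite_stdBox α β)).cast_ncard_eq, ← (finite_bdry hfin).cast_ncard_eq,
      ncard_bdry_stdBox hshape (by omega), hn]
  have hle := hmax (stdBox α β) (finite_stdBox α β) hbdry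
  rw [← (finite_stdBox α β).cast_ncard_eq, ← hfin.cast_ncard_eq, Nat.cast_le] at hle
  have hext : (α + β + 2 : ℤ) ^ 2 - 1 ≤ 8 * ((stdBox α β).ncard : ℤ) :=
    (sq_sub_one_le_eight_mul_ncard_stdBox_iff (by omega)).2 (hshape.imp_right Or.inl)
  refine ⟨hfin, ?_⟩
  rw [hn, show ((α + β + 4 : ℕ) - 2 : ℤ) = α + β + 2 by push_cast; ring]
  omega

lemma isEfficient_iff_nearlyExtremal {A : Set (ℤ × ℤ)} (hne : A.Nonempty) :
    IsEfficient A ↔ NearlyExtremal A :=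
  ⟨fun hA => hA.nearlyExtremal hne, NearlyExtremal.isEfficient⟩

lemma NearlyExtremal.isSaturated {A : Set (ℤ × ℤ)} (hA : NearlyExtremal A) : IsSaturated A := by
  obtain ⟨hfin, hext⟩ := hA
  intro v hv
  rw [Set.union_singleton]
  have hfin' : (insert v A).Finite := hfin.insert v
  rw [← (finite_bdry hfin).cast_ncard_eq, ← (finite_bdry hfin').cast_ncard_eq, Nat.cast_lt]
  by_contra! hle
  obtain ⟨hfour, hiso⟩ := isoperimetric hfin' (Set.insert_nonempty v A)
  rw [Set.ncard_insert_of_notMem hv hfin] at hiso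
  have : ((bdry (insert v A)).ncard - 2 : ℤ) ^ 2 ≤ ((bdry A).ncard - 2 : ℤ) ^ 2 :=
    pow_le_pow_left₀ (by omega) (by omega) 2
  push_cast at hiso
  linarith

lemma NearlyExtremal.isMinimalSet {A : Set (ℤ × ℤ)} (hA : NearlyExtremal A) :
    IsMinimalSet A := by
  have hfive := ncard_bdry_ne_five hA.1 hA.nonempty
  refine ⟨hA.1, fun B hB => ?_⟩
  have hfinB : B.Finite := Set.encard_lt_top_iff.1 (hB ▸ hA.1.encard_lt_top)
  have hneB : B.Nonempty := Set.encard_pos.1 (hB ▸ Set.encard_pos.2 hA.nonempty)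
  have hcard : B.ncard = A.ncard := congrArg ENat.toNat hB
  rw [← (finite_bdry hA.1).cast_ncard_eq, ← (finite_bdry hfinB).cast_ncard_eq, Nat.cast_le]
  by_contra! hlt
  obtain ⟨hfour, hiso⟩ := isoperimetric hfinB hneB
  have hsq : ((bdry B).ncard - 2 : ℤ) ^ 2 ≤ ((bdry A).ncard - 3 : ℤ) ^ 2 :=
    pow_le_pow_left₀ (by omega) (by omega) 2
  have hsix : (6 : ℤ) ≤ (bdry A).ncard := by omega
  rw [hcard] at hiso
  nlinarith [hA.2]

lemma NearlyExtremal.isBox {A : Set (ℤ × ℤ)} (hA : NearlyExtremal A) : IsBox A := by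
  obtain ⟨α, β, -, hcong, -⟩ := hA.exists_congruent_stdBox
  exact ⟨hA.nonempty, Or.inl ⟨α, β, hcong⟩⟩

end LatticeIso

theorem theoremD (A : Set (ℤ × ℤ)) (hA : A.Nonempty) :
    (LatticeIso.IsEfficient A ↔
      ∃ n : ℕ, LatticeIso.Congruent A (LatticeIso.stdBox n n) ∨
        LatticeIso.Congruent A (LatticeIso.stdBox n (n + 1)) ∨
        LatticeIso.Congruent A (LatticeIso.stdBox (2 * n) (2 * n + 2))) ∧
    (LatticeIso.IsEfficient A →
      LatticeIso.IsMinimalSet A ∧ LatticeIso.IsSaturated A ∧ LatticeIso.IsBox A) := by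
  rw [LatticeIso.isEfficient_iff_nearlyExtremal hA]
  exact ⟨LatticeIso.nearlyExtremal_iff_congruent,
    fun h => ⟨h.isMinimalSet, h.isSaturated, h.isBox⟩⟩
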